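/- Let $R$ be a real closed field containing $\mathbb R$ as a subfield, let $\mathcal O=\{a\in R\mid \exists N\in\mathbb N: -N\le a\le N\}$ be its ring of finite elements, and for $a\in\mathcal O$ let $\operatorname{st}(a)\in\mathbb R$ denote its standard part, i.e., the unique real number with $|a-\operatorname{st}(a)|\le\frac1N$ for all $N\in\mathbb N$ with $N\ge1$; for a point of $\mathcal O^n$, standard parts are taken coordinatewise. Let $n\in\mathbb N_0$ and write $\mathcal O[X]=\mathcal O[X_1,\dots,X_n]$. Let $M\subseteq\mathcal O[X]$ be an Archimedean quadratic module, that is, $0,1\in M$, $M+M\subseteq M$, $p^2M\subseteq M$ for all $p\in\mathcal O[X]$, and for every $p\in\mathcal O[X]$ there is $N\in\mathbb N$ with $N+p\in M$ and $N-p\in M$. Set $$S:=\{x\in\mathbb R^n\mid \operatorname{st}(p(x))\ge0\text{ for all }p\in M\}.$$ Let $k\in\mathbb N_0$ and let $x_1,\dots,x_k\in\mathcal O^n$ have pairwise distinct standard parts. For $x\in\mathcal O^n$ let $I_x:=\{p\in\mathcal O[X]\mid p(x)=0\}$, and let $$f\in\bigcap_{i=1}^k I_{x_i}^2$$ (for $k=0$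 the intersection is all of $\mathcal O[X]$), where $I_{x_i}^2$ is the square of the ideal $I_{x_i}$. Suppose that $$\operatorname{st}(f(x))>0\quad\text{for all }x\in S\setminus\{\operatorname{st}(x_1),\dots,\operatorname{st}(x_k)\}$$ and $$\operatorname{st}\bigl(v^T(\operatorname{Hess} f)(x_i)\,v\bigr)>0\quad\text{for all }i\in\{1,\dots,k\}\text{ and all }v\in\mathbb R^n\setminus\{0\},$$ where $\operatorname{Hess} f$ is the matrix of formal second partial derivatives of $f$. Then $f\in M$. -/

import Mathlib

open ArchimedeanClass

/-! For an ordered field `R`, Mathlib's `FiniteElement R` is the ring of finite elements, i.e. those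
bounded in absolute value by a natural number (see `mk_nonneg_iff`), and `stdPart` is the standard
part. -/

noncomputable section

namespace RealClosedPositivity

/-- A quadratic module of a commutative ring `A`: a subset `M` containing `0` and `1`
with `M + M ⊆ M` and `A² M ⊆ M`. -/
structure IsQuadraticModule {A : Type*} [CommRing A] (M : Set A) : Prop where
  zero_mem : (0 : A) ∈ M
  one_mem : (1 : A) ∈ M
  add_mem : ∀ {a b : A}, a ∈ M → b ∈ M → a + b ∈ M
  sq_mul_mem : ∀ (a : A) {b : A}, b ∈ M → a ^ 2 * b ∈ M

/-- `M` is Archimedean: for every `a` there is a natural number `N` with `N ± a ∈ M`. -/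
def IsArchimedean {A : Type*} [CommRing A] (M : Set A) : Prop :=
  ∀ a : A, ∃ N : ℕ, (N : A) + a ∈ M ∧ (N : A) - a ∈ M

section Finite

variable {R : Type*} [Field R] [LinearOrder R] [IsStrictOrderedRing R]

/-- An element of `R` underlies an element of `FiniteElement R` exactly if `-N ≤ a ≤ N` for some
`N : ℕ`. -/
theorem mk_nonneg_iff (a : R) :
    0 ≤ ArchimedeanClass.mk a ↔ ∃ N : ℕ, -(N : R) ≤ a ∧ a ≤ N := by
  rw [← ArchimedeanClass.mk_one, ArchimedeanClass.mk_le_mk]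
  simp [abs_le]

/-- The standard part of a finite element: the real number infinitesimally close to it. -/
def st (a : FiniteElement R) : ℝ := stdPart a.1

variable [Algebra ℝ R]

theorem algebraMap_nonneg {r : ℝ} (hr : 0 ≤ r) : 0 ≤ algebraMap ℝ R r := by
  rw [← Real.mul_self_sqrt hr, map_mul]
  exact mul_self_nonneg _

theorem algebraMap_finite (r : ℝ) : 0 ≤ ArchimedeanClass.mk (algebraMap ℝ R r) := by
  rw [mk_nonneg_iff]
  obtain ⟨N, hN⟩ := exists_nat_ge |r|
  refine ⟨N, ?_, ?_⟩
  · have h := algebraMap_nonneg (R := R) (r := r + N) (by linarith [neg_abs_le r])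
    rw [map_add, map_natCast] at h
    linarith
  · have h := algebraMap_nonneg (R := R) (r := N - r) (by linarith [le_abs_self r])
    rw [map_sub, map_natCast] at h
    linarith

variable (R) in
/-- The inclusion of `ℝ` into the ring of finite elements of `R`. -/
def ofReal : ℝ →+* FiniteElement R where
  toFun r := FiniteElement.mk (algebraMap ℝ R r) (algebraMap_finite r)
  map_zero' := by ext; exact map_zero (algebraMap ℝ R)
  map_one' := by ext; exact map_one (algebraMap ℝ R)
  map_add' a b := by ext; exact map_add (algebraMap ℝ R) a b
  map_mul' a b := by ext; exact map_mul (algebraMap ℝ R) a b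

end Finite

section Polynomials

variable {A : Type*} [CommRing A] {n : ℕ}

/-- The ideal `I_x` of all polynomials vanishing at the point `x`. -/
def pointIdeal (x : Fin n → A) : Ideal (MvPolynomial (Fin n) A) :=
  RingHom.ker (MvPolynomial.eval x)

/-- The Hessian of a polynomial (formal partial derivatives). -/
def hess (p : MvPolynomial (Fin n) A) : Matrix (Fin n) (Fin n) (MvPolynomial (Fin n) A) :=
  Matrix.of fun i j => MvPolynomial.pderiv i (MvPolynomial.pderiv j p)

/-- The Hessian of a polynomial evaluated at the point `x`. -/
def hessAt (p : MvPolynomial (Fin n) A) (x : Fin n → A) : Matrix (Fin n) (Fin n) A :=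
  (hess p).map (MvPolynomial.eval x)

end Polynomials

section Points

variable {R : Type*} [Field R] [LinearOrder R] [IsStrictOrderedRing R] {n : ℕ}

/-- Coordinatewise standard part of a point with finite coordinates. -/
def stPt (x : Fin n → FiniteElement R) : Fin n → ℝ := fun i => st (x i)

variable [Algebra ℝ R]

variable (R) in
/-- A real vector regarded as a vector with finite coordinates in `R`. -/
def ofRealPt (y : Fin n → ℝ) : Fin n → FiniteElement R := fun i => ofReal R (y i)

/-- The set `S = {y ∈ ℝⁿ | ∀ p ∈ M, st (p(y)) ≥ 0}`. -/
def positivitySet (M : Set (MvPolynomial (Fin n) (FiniteElement R))) : Set (Fin n → ℝ) :=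
  {y | ∀ p ∈ M, 0 ≤ st (MvPolynomial.eval (ofRealPt R y) p)}

end Points

end RealClosedPositivity

end

open RealClosedPositivity

/-!
The proof goes through pure states on an ideal. Put `J = ∏ᵢ I_{xᵢ}`. The points `xᵢ` have distinct
standard parts, so their ideals are pairwise coprime and `⨅ᵢ I_{xᵢ}² = J²`
(`iInf_pointIdeal_sq`). Since `M` is Archimedean, the sum `u` of the squares of finitely many
generators of `J` is an order unit of the real vector space `J²` ordered by the cone `M ∩ J²`
(`IsArchimedean.sum_sq_orderUnit`). If `f ∈ J²` is not in `M`, then the Riesz extension theorem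
and the Krein–Milman theorem provide a pure state `φ` of `(J², M ∩ J², u)` with `φ f ≤ 0`
(`exists_pure_state_nonpos`).

Pure states are multiplicative: `φ (a b) = Φ a * φ b` with a ring homomorphism `Φ` from the
polynomial ring to `ℝ` that is nonnegative on `M` (`IsArchimedean.exists_multiplicative_state`).
The cone `M ∩ J²` is stable only under multiplication by squares, so the point is that
multiplication by `1 - p²`, for `1 - p² ∈ M`, also preserves nonnegativity of `φ`. This holds as the
sequence `φ (p²ᵏ b)` is log-convex and bounded (`IsQuadraticModule.map_sq_smul_le`). The
only ring homomorphism from the finite elements to `ℝ` is the standard part (`ringHom_eq_stHom`),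
hence `Φ` is the standard part of evaluation at some `y ∈ S`.

* If `y` is not the standard part of any `xᵢ`, then `Φ u * φ f = φ (u f) = Φ f > 0` and `Φ u ≥ 0`,
  so `φ f > 0`.
* If `y` is the standard part of `xᵢ`, then `φ` behaves like a second-order differential operator
  at `xᵢ`: up to a positive factor, `φ f` is `∑ H_{kl} B_{kl}`, where `H` is the standard part of
  the Hessian of `f` at `xᵢ` and `B` is a Gram matrix of `φ`, positive semidefinite and nonzero
  (`two_mul_map_eq_sum_hessAt_mul_gramMatrix`). As `H` is positive definite, again `φ f > 0`
  (`map_pos_of_hessAt_pos`).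

Both cases contradict `φ f ≤ 0`.
-/

namespace RealClosedPositivity

/-! ### Pure states of ordered real vector spaces with an order unit -/

section PureStates

variable {V : Type*} [AddCommGroup V] [Module ℝ V]

/-- The states of the cone `C` with respect to the order unit `u`: linear functionals that are
nonnegative on `C` and take the value `1` at `u`. They are regarded as points of `V → ℝ`, so that
the topology on them is that of pointwise convergence. -/
def stateSpace (C : PointedCone ℝ V) (u : V) : Set (V → ℝ) :=
  {g | (∀ v w, g (v + w) = g v + g w) ∧ (∀ (c : ℝ) v, g (c • v) = c * g v) ∧
    (∀ v ∈ C, 0 ≤ g v) ∧ g u = 1}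

theorem coe_mem_stateSpace {C : PointedCone ℝ V} {u : V} {φ : V →ₗ[ℝ] ℝ}
    (hφ : ∀ v ∈ C, 0 ≤ φ v) (hu : φ u = 1) : (φ : V → ℝ) ∈ stateSpace C u :=
  ⟨fun v w => map_add φ v w, fun c v => map_smul φ c v, hφ, hu⟩

theorem isCompact_stateSpace {C : PointedCone ℝ V} {u : V}
    (hC : ∀ v, ∃ N : ℝ, N • u + v ∈ C) : IsCompact (stateSpace C u) := by
  choose N hN using hC
  refine (isCompact_univ_pi fun v => isCompact_Icc (a := -N v) (b := N (-v))).of_isClosed_subset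
    ?_ fun g hg v _ => ?_
  · simp only [stateSpace, Set.ofPred_and, Set.ofPred_forall]
    refine IsClosed.inter ?_ (IsClosed.inter ?_ (IsClosed.inter ?_ ?_))
    · exact isClosed_iInter fun v => isClosed_iInter fun w =>
        isClosed_eq (by fun_prop) (by fun_prop)
    · exact isClosed_iInter fun c => isClosed_iInter fun v =>
        isClosed_eq (by fun_prop) (by fun_prop)
    · exact isClosed_iInter fun v => isClosed_iInter fun _ =>
        isClosed_le (by fun_prop) (by fun_prop)
    · exact isClosed_eq (by fun_prop) (by fun_prop)
  · obtain ⟨hadd, hsmul, hpos, hone⟩ := hg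
    have h1 := hpos _ (hN v)
    have h2 := hpos _ (hN (-v))
    have hneg : g (-v) = -g v := by simpa using hsmul (-1) v
    rw [hadd, hsmul, hone] at h1 h2
    constructor <;> linarith

/-- An element outside a cone with an order unit is nonpositive under some state: the functional
`t • u ↦ t` extends to a functional that is nonnegative on the cone generated by `C` and `-f`. -/
theorem exists_state_nonpos {C : PointedCone ℝ V} {u : V} (hu : u ∈ C)
    (hC : ∀ v, ∃ N : ℝ, N • u + v ∈ C) {f : V} (hf : f ∉ C) :
    ∃ φ : V →ₗ[ℝ] ℝ, (∀ v ∈ C, 0 ≤ φ v) ∧ φ u = 1 ∧ φ f ≤ 0 := by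
  have smul_mem : ∀ {c : ℝ} {v : V}, 0 ≤ c → v ∈ C → c • v ∈ C := fun {c v} hc hv =>
    C.smul_mem hc hv
  -- If `-u` were in `C`, the order unit property would put every element into `C`.
  have hneg_u : -u ∉ C := by
    intro h
    obtain ⟨N, hN⟩ := hC f
    refine hf ?_
    rcases le_total 0 N with h0 | h0
    · have := C.add_mem hN (smul_mem h0 h)
      rwa [smul_neg, add_assoc, add_comm f, ← add_assoc, add_neg_cancel, zero_add] at this
    · have := C.add_mem hN (smul_mem (neg_nonneg.2 h0) hu)
      rwa [neg_smul, add_assoc, add_comm f, ← add_assoc, add_neg_cancel, zero_add] at this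
  have hu0 : u ≠ 0 := by
    rintro rfl
    exact hneg_u (by simp)
  let D : PointedCone ℝ V := C ⊔ PointedCone.hull ℝ {-f}
  have hCD : C ≤ D := le_sup_left
  have hfD : -f ∈ D := le_sup_right (a := C) (Submodule.subset_span rfl)
  have hneg_u' : -u ∉ D := by
    intro h
    obtain ⟨c, hc, d, hd, hcd⟩ := Submodule.mem_sup.1 h
    obtain ⟨t, rfl⟩ := Submodule.mem_span_singleton.1 hd
    have hcd' : c + (t : ℝ) • (-f) = -u := hcd
    rcases eq_or_lt_of_le t.2 with h0 | h0
    · have h0' : (t : ℝ) = 0 := h0.symm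
      rw [h0', zero_smul, add_zero] at hcd'
      exact hneg_u (hcd' ▸ hc)
    · have h1 : (t : ℝ) • f = c + u := by
        rw [smul_neg, add_neg_eq_iff_eq_add] at hcd'
        rw [hcd', add_right_comm, neg_add_cancel, zero_add]
      have h2 := smul_mem (inv_nonneg.2 h0.le) (C.add_mem hc hu)
      rw [← h1] at h2
      have h3 : (t : ℝ) ≠ 0 := h0.ne'
      exact hf (by rwa [show (t.1)⁻¹ • (t : ℝ) • f = f from inv_smul_smul₀ h3 f] at h2)
  obtain ⟨g, hg, hgD⟩ := riesz_extension D (LinearPMap.mkSpanSingleton u (1 : ℝ) hu0)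
    (by
      rintro ⟨v, hv⟩ hvD
      obtain ⟨t, rfl⟩ := Submodule.mem_span_singleton.1 hv
      have hgt : LinearPMap.mkSpanSingleton u (1 : ℝ) hu0 ⟨t • u, hv⟩ = t := by
        simpa using LinearPMap.mkSpanSingleton'_apply (σ := RingHom.id ℝ) u (1 : ℝ) _ t hv
      change 0 ≤ LinearPMap.mkSpanSingleton u (1 : ℝ) hu0 ⟨t • u, hv⟩
      rw [hgt]
      by_contra! ht
      refine hneg_u' ?_
      have h' : ((-t)⁻¹ : ℝ) • t • u ∈ D := D.smul_mem (inv_nonneg.2 (neg_nonneg.2 ht.le)) hvD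
      rwa [smul_smul, show (-t)⁻¹ * t = -1 by rw [inv_neg, neg_mul, inv_mul_cancel₀ ht.ne],
        neg_one_smul] at h')
    (fun y => by
      obtain ⟨N, hN⟩ := hC y
      exact ⟨⟨N • u, Submodule.smul_mem _ _ (Submodule.mem_span_singleton_self u)⟩, hCD hN⟩)
  refine ⟨g, fun v hv => hgD v (hCD hv), ?_, ?_⟩
  · exact (hg ⟨u, Submodule.mem_span_singleton_self u⟩).trans
      (LinearPMap.mkSpanSingleton_apply ℝ ℝ hu0 1)
  · have := hgD _ hfD
    rw [map_neg] at this
    linarith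

/-- A functional that is nonnegative on a cone with order unit `u` vanishes if it does at `u`. -/
theorem eq_zero_of_orderUnit {C : PointedCone ℝ V} {u : V}
    (hC : ∀ v, ∃ N : ℝ, N • u + v ∈ C) {ψ : V →ₗ[ℝ] ℝ} (hψ : ∀ v ∈ C, 0 ≤ ψ v)
    (hu : ψ u = 0) (v : V) : ψ v = 0 := by
  obtain ⟨N, hN⟩ := hC v
  obtain ⟨N', hN'⟩ := hC (-v)
  have h1 := hψ _ hN
  have h2 := hψ _ hN'
  simp only [map_add, map_smul, map_neg, hu, smul_zero, zero_add] at h1 h2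
  linarith

/-- An extreme point of the state space dominates only its own multiples. -/
theorem eq_mul_of_mem_extremePoints {C : PointedCone ℝ V} {u : V} (hu : u ∈ C)
    (hC : ∀ v, ∃ N : ℝ, N • u + v ∈ C) {φ : V →ₗ[ℝ] ℝ}
    (hφ : (φ : V → ℝ) ∈ (stateSpace C u).extremePoints ℝ) {ψ : V →ₗ[ℝ] ℝ}
    (hψ : ∀ v ∈ C, 0 ≤ ψ v) (hφψ : ∀ v ∈ C, ψ v ≤ φ v) (v : V) : ψ v = ψ u * φ v := by
  have hφu : φ u = 1 := hφ.1.2.2.2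
  have hsub : ∀ v ∈ C, 0 ≤ (φ - ψ) v := fun v hv => sub_nonneg.2 (hφψ v hv)
  rcases eq_or_lt_of_le (hψ u hu) with h0 | h0
  · rw [eq_zero_of_orderUnit hC hψ h0.symm v, ← h0, zero_mul]
  rcases eq_or_lt_of_le (hφψ u hu) with h1 | h1
  · have := eq_zero_of_orderUnit hC hsub (by simp [h1]) v
    rw [LinearMap.sub_apply, sub_eq_zero] at this
    rw [h1, hφu, one_mul, this]
  rw [hφu] at h1
  have h1' : 0 < 1 - ψ u := sub_pos.2 h1
  have key := hφ.2 (x₁ := ((ψ u)⁻¹ • ψ : V →ₗ[ℝ] ℝ)) (x₂ := ((1 - ψ u)⁻¹ • (φ - ψ) : V →ₗ[ℝ] ℝ))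
    (coe_mem_stateSpace (fun v hv => mul_nonneg (inv_nonneg.2 h0.le) (hψ v hv))
      (inv_mul_cancel₀ h0.ne'))
    (coe_mem_stateSpace (fun v hv => mul_nonneg (inv_nonneg.2 h1'.le) (hsub v hv))
      (by simp [hφu, inv_mul_cancel₀ h1'.ne']))
    ⟨ψ u, 1 - ψ u, h0, h1', by ring, by
      ext w
      simp [mul_inv_cancel_left₀ h0.ne', mul_inv_cancel_left₀ h1'.ne']⟩
  have := congrFun key v
  simp only [LinearMap.smul_apply, smul_eq_mul] at this
  rw [← this, mul_inv_cancel_left₀ h0.ne']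

/-- An element outside a cone with order unit `u` is nonpositive under some pure state. Such a state
is an extreme point of the face of states at which the value of `f` is minimal. -/
theorem exists_pure_state_nonpos {C : PointedCone ℝ V} {u : V} (hu : u ∈ C)
    (hC : ∀ v, ∃ N : ℝ, N • u + v ∈ C) {f : V} (hf : f ∉ C) :
    ∃ φ : V →ₗ[ℝ] ℝ, (∀ v ∈ C, 0 ≤ φ v) ∧ φ u = 1 ∧ φ f ≤ 0 ∧
      ∀ ψ : V →ₗ[ℝ] ℝ, (∀ v ∈ C, 0 ≤ ψ v) → (∀ v ∈ C, ψ v ≤ φ v) →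
        ∀ v, ψ v = ψ u * φ v := by
  obtain ⟨φ₀, hφ₀, hφ₀u, hφ₀f⟩ := exists_state_nonpos hu hC hf
  have hcomp := isCompact_stateSpace hC
  have hφ₀mem := coe_mem_stateSpace hφ₀ hφ₀u
  -- The exposed face on which `l` is maximal is the one on which evaluation at `f` is minimal.
  let l : StrongDual ℝ (V → ℝ) := -ContinuousLinearMap.proj f
  have hexp : IsExposed ℝ (stateSpace C u) (l.toExposed (stateSpace C u)) :=
    ContinuousLinearMap.toExposed.isExposed
  obtain ⟨g₀, hg₀, hmax⟩ := hcomp.exists_isMaxOn ⟨_, hφ₀mem⟩ l.continuous.continuousOn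
  obtain ⟨g, hg⟩ := (hexp.isCompact hcomp).extremePoints_nonempty ⟨g₀, hg₀, hmax⟩
  have hext := hexp.isExtreme.extremePoints_subset_extremePoints hg
  let φ : V →ₗ[ℝ] ℝ :=
    { toFun := g, map_add' := hext.1.1, map_smul' := hext.1.2.1 }
  refine ⟨φ, hext.1.2.2.1, hext.1.2.2.2, ?_, fun ψ hψ hψφ =>
    eq_mul_of_mem_extremePoints (φ := φ) hu hC hext hψ hψφ⟩
  have h : -φ₀ f ≤ -g f := hg.1.2 _ hφ₀mem
  change g f ≤ 0
  linarith

end PureStates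

/-! ### Archimedean quadratic modules and squares of ideals -/

section Multiplicativity

variable {A : Type*} [CommRing A] {M : Set A}

theorem IsQuadraticModule.sq_mem (hM : IsQuadraticModule M) (a : A) : a ^ 2 ∈ M := by
  simpa using hM.sq_mul_mem a hM.one_mem

theorem IsQuadraticModule.sum_mem (hM : IsQuadraticModule M) {ι : Type*} (s : Finset ι)
    {g : ι → A} (hg : ∀ i ∈ s, g i ∈ M) : ∑ i ∈ s, g i ∈ M :=
  Finset.sum_induction g (· ∈ M) (fun _ _ => hM.add_mem) hM.zero_mem hg

theorem IsQuadraticModule.one_sub_pow_mem (hM : IsQuadraticModule M) {p : A}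
    (hp : 1 - p ^ 2 ∈ M) (k : ℕ) : 1 - (p ^ 2) ^ k ∈ M := by
  induction k with
  | zero => simpa using hM.zero_mem
  | succ k ih =>
    rw [show 1 - (p ^ 2) ^ (k + 1) = (1 - (p ^ 2) ^ k) + (p ^ k) ^ 2 * (1 - p ^ 2) by ring]
    exact hM.add_mem ih (hM.sq_mul_mem _ hp)

variable [Algebra ℝ A]

theorem IsQuadraticModule.smul_mem (hM : IsQuadraticModule M) {c : ℝ} (hc : 0 ≤ c) {a : A}
    (ha : a ∈ M) : c • a ∈ M := by
  have := hM.sq_mul_mem (algebraMap ℝ A √c) ha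
  rwa [← map_pow, Real.sq_sqrt hc, ← Algebra.smul_def] at this

theorem mul_eq_sq_sub_sq (g h : A) :
    g * h = ((2⁻¹ : ℝ) • (g + h)) ^ 2 - ((2⁻¹ : ℝ) • (g - h)) ^ 2 := by
  have h4 : algebraMap ℝ A 2⁻¹ ^ 2 * 4 = 1 := by
    rw [← map_pow, ← map_ofNat (algebraMap ℝ A) 4, ← map_mul]
    norm_num
  simp only [Algebra.smul_def]
  linear_combination (-g * h) * h4

/-- The cone of elements of `J²` that belong to the quadratic module `M`. -/
def quadraticModuleCone (hM : IsQuadraticModule M) (J : Ideal A) :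
    PointedCone ℝ ↥(J ^ 2) where
  carrier := {b | (b : A) ∈ M}
  add_mem' ha hb := hM.add_mem ha hb
  zero_mem' := hM.zero_mem
  smul_mem' c _ hb := hM.smul_mem c.2 hb

/-- The powers of a square `p²` with `1 - p² ∈ M` act boundedly on `J²`. For a product `b` of two
elements of `J`, written as `c² - d²`, the bound `w = c²` works. -/
theorem IsQuadraticModule.exists_sub_pow_mul_mem (hM : IsQuadraticModule M) {J : Ideal A} {p : A}
    (hp : 1 - p ^ 2 ∈ M) {b : A} (hb : b ∈ J ^ 2) :
    ∃ w ∈ J ^ 2, ∀ k : ℕ, w - (p ^ 2) ^ k * b ∈ M := by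
  rw [pow_two] at hb
  induction hb using Submodule.mul_induction_on' with
  | mem_mul_mem g hg h hh =>
    have hc : (2⁻¹ : ℝ) • (g + h) ∈ J := Submodule.smul_of_tower_mem J _ (J.add_mem hg hh)
    refine ⟨((2⁻¹ : ℝ) • (g + h)) ^ 2, Ideal.pow_mem_pow hc 2, fun k => ?_⟩
    rw [mul_eq_sq_sub_sq g h]
    set c := (2⁻¹ : ℝ) • (g + h)
    set d := (2⁻¹ : ℝ) • (g - h)
    rw [show c ^ 2 - (p ^ 2) ^ k * (c ^ 2 - d ^ 2) =
      c ^ 2 * (1 - (p ^ 2) ^ k) + (p ^ k * d) ^ 2 by ring]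
    exact hM.add_mem (hM.sq_mul_mem _ (hM.one_sub_pow_mem hp k)) (hM.sq_mem _)
  | add x _ y _ hx hy =>
    obtain ⟨v, hv, hvM⟩ := hx
    obtain ⟨w, hw, hwM⟩ := hy
    refine ⟨v + w, Ideal.add_mem _ hv hw, fun k => ?_⟩
    rw [show v + w - (p ^ 2) ^ k * (x + y) =
      (v - (p ^ 2) ^ k * x) + (w - (p ^ 2) ^ k * y) by ring]
    exact hM.add_mem (hvM k) (hwM k)

theorem IsArchimedean.exists_smul_one_sub_mem (hM : IsQuadraticModule M) (hA : IsArchimedean M)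
    (a : A) : ∃ N : ℝ, 0 < N ∧ N • 1 - a ∈ M := by
  obtain ⟨N, -, hN⟩ := hA a
  refine ⟨N + 1, by positivity, ?_⟩
  rw [show ((N : ℝ) + 1) • (1 : A) - a = (N - a) + 1 by
    rw [Algebra.smul_def, map_add, map_natCast, map_one]; ring]
  exact hM.add_mem hN hM.one_mem

/-- The sum of the squares of generators of `J` is an order unit of `J²`. -/
theorem IsArchimedean.sum_sq_orderUnit (hM : IsQuadraticModule M) (hA : IsArchimedean M)
    (s : Finset A) {b : A} (hb : b ∈ (Ideal.span (s : Set A)) ^ 2) :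
    ∃ N : ℝ, N • ∑ g ∈ s, g ^ 2 + b ∈ M := by
  set u := ∑ g ∈ s, g ^ 2
  have key : ∀ c ∈ Ideal.span (s : Set A), ∃ N : ℝ, N • u - c ^ 2 ∈ M := by
    intro c hc
    induction hc using Submodule.span_induction with
    | mem g hg =>
      classical
      refine ⟨1, ?_⟩
      rw [one_smul, ← Finset.sum_erase_eq_sub (f := fun g : A => g ^ 2) (Finset.mem_coe.1 hg)]
      exact hM.sum_mem _ fun i _ => hM.sq_mem i
    | zero => exact ⟨0, by simpa using hM.zero_mem⟩
    | add c d _ _ hc hd =>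
      obtain ⟨N, hN⟩ := hc
      obtain ⟨N', hN'⟩ := hd
      refine ⟨2 * N + 2 * N', ?_⟩
      -- `(c + d)² = 2c² + 2d² - (c - d)²`
      have h := hM.add_mem (hM.add_mem (hM.smul_mem zero_le_two hN) (hM.smul_mem zero_le_two hN'))
        (hM.sq_mem (c - d))
      convert h using 1
      simp only [Algebra.smul_def, map_add, map_mul, map_ofNat]
      ring
    | smul a c _ hc =>
      obtain ⟨N, hN⟩ := hc
      obtain ⟨N', hN'0, hN'⟩ := hA.exists_smul_one_sub_mem hM (a ^ 2)
      refine ⟨N' * N, ?_⟩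
      have h := hM.add_mem (hM.smul_mem hN'0.le hN) (hM.sq_mul_mem c hN')
      convert h using 1
      simp only [Algebra.smul_def, map_mul, Algebra.algebraMap_self, RingHom.id_apply]
      ring
  rw [pow_two] at hb
  induction hb using Submodule.mul_induction_on' with
  | mem_mul_mem g hg h hh =>
    have hd : (2⁻¹ : ℝ) • (g - h) ∈ Ideal.span (s : Set A) :=
      Submodule.smul_of_tower_mem _ _ (Ideal.sub_mem _ hg hh)
    obtain ⟨N, hN⟩ := key _ hd
    refine ⟨N, ?_⟩
    rw [mul_eq_sq_sub_sq g h, add_sub_left_comm, ← add_sub_assoc, add_sub_assoc]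
    exact hM.add_mem (hM.sq_mem _) hN
  | add x _ y _ hx hy =>
    obtain ⟨N, hN⟩ := hx
    obtain ⟨N', hN'⟩ := hy
    refine ⟨N + N', ?_⟩
    rw [add_smul, add_add_add_comm]
    exact hM.add_mem hN hN'

/-! ### Multiplicativity of pure states -/

/-- A bounded log-convex sequence of nonnegative reals does not increase at its first step:
otherwise it would dominate a geometric progression of ratio `m 1 / m 0 > 1`. -/
theorem le_of_logConvex_of_bounded {m : ℕ → ℝ} (h0 : ∀ k, 0 ≤ m k)
    (hlog : ∀ k, m (k + 1) ^ 2 ≤ m k * m (k + 2)) {B : ℝ} (hB : ∀ k, m k ≤ B) : m 1 ≤ m 0 := by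
  by_contra! hlt
  have hm0 : 0 < m 0 := by
    refine lt_of_le_of_ne (h0 0) fun h => ?_
    have := hlog 0
    rw [← h, zero_mul] at this
    nlinarith
  have hr : 1 < m 1 / m 0 := (one_lt_div hm0).2 hlt
  set r := m 1 / m 0 with hr_def
  have step : ∀ k, 0 < m k ∧ r * m k ≤ m (k + 1) := by
    intro k
    induction k with
    | zero => exact ⟨hm0, (div_mul_cancel₀ _ hm0.ne').le⟩
    | succ k ih =>
      obtain ⟨hk, hk1⟩ := ih
      have hpos : 0 < m (k + 1) := lt_of_lt_of_le (by positivity) hk1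
      refine ⟨hpos, le_of_mul_le_mul_left ?_ hk⟩
      calc m k * (r * m (k + 1)) = r * m k * m (k + 1) := by ring
        _ ≤ m (k + 1) * m (k + 1) := by gcongr
        _ ≤ m k * m (k + 2) := by rw [← pow_two]; exact hlog k
  have hpow : ∀ k, r ^ k * m 0 ≤ m k := by
    intro k
    induction k with
    | zero => simp
    | succ k ih =>
      calc r ^ (k + 1) * m 0 = r * (r ^ k * m 0) := by ring
        _ ≤ r * m k := by gcongr
        _ ≤ m (k + 1) := (step k).2
  obtain ⟨k, hk⟩ := pow_unbounded_of_one_lt (B / m 0) hr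
  have := (div_lt_iff₀ hm0).1 hk
  linarith [hpow k, hB k]

/-- Multiplication by a square `p²` with `1 - p² ∈ M` does not increase the values on `M ∩ J²` of a
functional that is nonnegative there: the sequence `k ↦ φ (p²ᵏ b)` is bounded, and log-convex by the
Cauchy–Schwarz inequality. -/
theorem IsQuadraticModule.map_sq_smul_le (hM : IsQuadraticModule M) {J : Ideal A}
    {φ : ↥(J ^ 2) →ₗ[ℝ] ℝ} (hφ : ∀ b : ↥(J ^ 2), (b : A) ∈ M → 0 ≤ φ b) {p : A}
    (hp : 1 - p ^ 2 ∈ M) {b : ↥(J ^ 2)} (hb : (b : A) ∈ M) : φ (p ^ 2 • b) ≤ φ b := by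
  obtain ⟨w, hw, hwM⟩ := hM.exists_sub_pow_mul_mem hp b.2
  have hnn : ∀ q : A, 0 ≤ φ (q ^ 2 • b) := fun q => hφ _ (hM.sq_mul_mem q hb)
  have h := le_of_logConvex_of_bounded (m := fun k => φ ((p ^ 2) ^ k • b)) (B := φ ⟨w, hw⟩)
    (fun k => by rw [← pow_mul, mul_comm, pow_mul]; exact hnn _) (fun k => ?_) (fun k => ?_)
  · simpa using h
  · -- Expanding `φ ((pᵏ + t pᵏ⁺²)² b) ≥ 0` gives a nonnegative quadratic polynomial in `t`, whose
    -- discriminant is therefore nonpositive.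
    have hd : ∀ t : ℝ, 0 ≤ φ ((p ^ 2) ^ (k + 2) • b) * (t * t) +
        (2 * φ ((p ^ 2) ^ (k + 1) • b)) * t + φ ((p ^ 2) ^ k • b) := by
      intro t
      have := hnn (p ^ k + t • p ^ (k + 2))
      rw [show (p ^ k + t • p ^ (k + 2)) ^ 2 • b = (t * t) • (p ^ 2) ^ (k + 2) • b +
        (2 * t) • (p ^ 2) ^ (k + 1) • b + (p ^ 2) ^ k • b by
          ext
          simp only [Submodule.coe_add, Submodule.coe_smul, Submodule.coe_smul_of_tower,
            Algebra.smul_def, map_mul, map_ofNat, Algebra.algebraMap_self,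
            RingHom.id_apply]
          ring] at this
      simp only [map_add, map_smul, smul_eq_mul] at this
      linarith
    have := discrim_le_zero hd
    rw [discrim] at this
    nlinarith
  · have := hφ (⟨w, hw⟩ - (p ^ 2) ^ k • b) (hwM k)
    rw [map_sub] at this
    linarith

/-- Pure states on `J²` are multiplicative. For a square `a = p²` with `1 - p² ∈ M` the functional
`b ↦ φ (a b)` lies between `0` and `φ`, so it is a multiple of `φ`; the general case follows since
every ring element is a difference of multiples of such squares. -/
theorem IsArchimedean.map_smul_of_pure (hM : IsQuadraticModule M) (hA : IsArchimedean M)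
    {J : Ideal A} {u : ↥(J ^ 2)} {φ : ↥(J ^ 2) →ₗ[ℝ] ℝ}
    (hφ : ∀ b : ↥(J ^ 2), (b : A) ∈ M → 0 ≤ φ b)
    (hpure : ∀ ψ : ↥(J ^ 2) →ₗ[ℝ] ℝ, (∀ b : ↥(J ^ 2), (b : A) ∈ M → 0 ≤ ψ b) →
      (∀ b : ↥(J ^ 2), (b : A) ∈ M → ψ b ≤ φ b) → ∀ b, ψ b = ψ u * φ b)
    (a : A) (b : ↥(J ^ 2)) : φ (a • b) = φ (a • u) * φ b := by
  have hsmul : ∀ (c : ℝ) (a : A) (b : ↥(J ^ 2)), φ ((c • a) • b) = c * φ (a • b) := by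
    intro c a b
    rw [smul_assoc, map_smul, smul_eq_mul]
  have hsq1 : ∀ p : A, 1 - p ^ 2 ∈ M → ∀ b, φ (p ^ 2 • b) = φ (p ^ 2 • u) * φ b := by
    intro p hp b
    let ψ : ↥(J ^ 2) →ₗ[ℝ] ℝ :=
      { toFun := fun b => φ (p ^ 2 • b)
        map_add' := fun b c => by rw [smul_add, map_add]
        map_smul' := fun c b => by
          rw [smul_comm, map_smul, RingHom.id_apply] }
    exact hpure ψ (fun b hb => hφ _ (hM.sq_mul_mem p hb))
      (fun b hb => hM.map_sq_smul_le hφ hp hb) b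
  have hsq : ∀ p : A, ∀ b, φ (p ^ 2 • b) = φ (p ^ 2 • u) * φ b := by
    intro p b
    obtain ⟨N, hN0, hN⟩ := hA.exists_smul_one_sub_mem hM (p ^ 2)
    have hscale : p ^ 2 = N • ((√N)⁻¹ • p) ^ 2 := by
      rw [smul_pow, smul_smul, inv_pow, Real.sq_sqrt hN0.le, mul_inv_cancel₀ hN0.ne', one_smul]
    have hmem : 1 - ((√N)⁻¹ • p) ^ 2 ∈ M := by
      have := hM.smul_mem (inv_nonneg.2 hN0.le) hN
      rw [smul_sub, smul_smul, inv_mul_cancel₀ hN0.ne', one_smul] at this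
      rw [smul_pow, inv_pow, Real.sq_sqrt hN0.le]
      exact this
    rw [hscale, hsmul, hsmul, hsq1 _ hmem, mul_assoc]
  have ha := mul_eq_sq_sub_sq a 1
  rw [mul_one] at ha
  rw [ha, sub_smul, sub_smul, map_sub, map_sub, hsq, hsq _ b]
  ring

/-- Nonmembership in an Archimedean quadratic module is detected by a pure state. Here `f ∈ J²` for
a finitely generated ideal `J`; the pure state is a functional on `J²` on which the ring acts
through the ring homomorphism `Φ = a ↦ φ (a u)`. -/
theorem IsArchimedean.exists_multiplicative_state (hM : IsQuadraticModule M)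
    (hA : IsArchimedean M) {J : Ideal A} (hJ : J.FG) {f : ↥(J ^ 2)} (hf : (f : A) ∉ M) :
    ∃ (φ : ↥(J ^ 2) →ₗ[ℝ] ℝ) (Φ : A →+* ℝ) (u : ↥(J ^ 2)),
      (∀ b : ↥(J ^ 2), (b : A) ∈ M → 0 ≤ φ b) ∧ (∀ a ∈ M, 0 ≤ Φ a) ∧
      (∀ a b, φ (a • b) = Φ a * φ b) ∧ (u : A) ∈ M ∧ φ u = 1 ∧ φ f ≤ 0 := by
  obtain ⟨s, rfl⟩ := hJ
  have huJ : ∑ g ∈ s, g ^ 2 ∈ (Ideal.span (s : Set A)) ^ 2 :=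
    Ideal.sum_mem _ fun g hg => Ideal.pow_mem_pow (Ideal.subset_span hg) 2
  let u : ↥((Ideal.span (s : Set A)) ^ 2) := ⟨_, huJ⟩
  have hu : (u : A) ∈ M := hM.sum_mem _ fun g _ => hM.sq_mem g
  obtain ⟨φ, hφ, hφu, hφf, hpure⟩ := exists_pure_state_nonpos
    (C := quadraticModuleCone hM (Ideal.span (s : Set A))) (u := u) hu
    (fun v => hA.sum_sq_orderUnit hM s v.2) hf
  have hmul := hA.map_smul_of_pure hM hφ hpure
  refine ⟨φ, ⟨⟨⟨fun a => φ (a • u), ?_⟩, fun a b => ?_⟩, ?_, fun a b => ?_⟩, u, hφ, fun a ha => ?_,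
    hmul, hu, hφu, hφf⟩
  · simpa using hφu
  · change φ ((a * b) • u) = φ (a • u) * φ (b • u)
    rw [mul_smul, hmul]
  · simp
  · change φ ((a + b) • u) = φ (a • u) + φ (b • u)
    rw [add_smul, map_add]
  · refine hφ _ ?_
    change a * ∑ g ∈ s, g ^ 2 ∈ M
    rw [mul_comm, Finset.sum_mul]
    exact hM.sum_mem _ fun g _ => hM.sq_mul_mem g ha

end Multiplicativity

open MvPolynomial Matrix

/-! ### Ideals of points -/

section PointIdeals

variable {A : Type*} [CommRing A] {n : ℕ}

theorem pointIdeal_eq_span (x : Fin n → A) :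
    pointIdeal x = Ideal.span (Set.range fun i => X i - C (x i)) := by
  refine le_antisymm (fun p hp => ?_) (Ideal.span_le.2 ?_)
  · have key : ∀ q : MvPolynomial (Fin n) A,
        q - C (eval x q) ∈ Ideal.span (Set.range fun i => X i - C (x i)) := by
      intro q
      induction q using MvPolynomial.induction_on with
      | C a => simp
      | add p q hp hq =>
        rw [map_add, map_add, add_sub_add_comm]
        exact Ideal.add_mem _ hp hq
      | mul_X p i hp =>
        rw [map_mul, eval_X, map_mul, show p * X i - C (eval x p) * C (x i) =
          X i * (p - C (eval x p)) + C (eval x p) * (X i - C (x i)) by ring]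
        exact Ideal.add_mem _ (Ideal.mul_mem_left _ _ hp)
          (Ideal.mul_mem_left _ _ (Ideal.subset_span ⟨i, rfl⟩))
    have := key p
    rwa [(RingHom.mem_ker).1 hp, map_zero, sub_zero] at this
  · rintro _ ⟨i, rfl⟩
    simp [pointIdeal, RingHom.mem_ker]

theorem X_sub_C_mem_pointIdeal (x : Fin n → A) (i : Fin n) : X i - C (x i) ∈ pointIdeal x := by
  simp [pointIdeal, RingHom.mem_ker]

theorem pointIdeal_fg (x : Fin n → A) : (pointIdeal x).FG := by
  rw [pointIdeal_eq_span]
  exact Submodule.fg_span (Set.finite_range _)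

theorem isCoprime_pointIdeal {x y : Fin n → A} {i : Fin n} (h : IsUnit (x i - y i)) :
    IsCoprime (pointIdeal x) (pointIdeal y) := by
  obtain ⟨c, hc⟩ := h.exists_left_inv
  refine Ideal.isCoprime_iff_exists.2 ⟨C (-c) * (X i - C (x i)),
    Ideal.mul_mem_left _ _ (X_sub_C_mem_pointIdeal x i), C c * (X i - C (y i)),
    Ideal.mul_mem_left _ _ (X_sub_C_mem_pointIdeal y i), ?_⟩
  rw [← C_1, ← hc]
  simp only [map_neg, map_mul, map_sub]
  ring

/-- Elements of the square of the ideal of a point are quadratic in the coordinates centered at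
that point, with polynomial coefficients. -/
theorem exists_eq_sum_of_mem_pointIdeal_sq {x : Fin n → A} {f : MvPolynomial (Fin n) A}
    (hf : f ∈ pointIdeal x ^ 2) : ∃ s : Fin n → Fin n → MvPolynomial (Fin n) A,
      f = ∑ k, ∑ l, s k l * ((X k - C (x k)) * (X l - C (x l))) := by
  rw [pow_two] at hf
  induction hf using Submodule.mul_induction_on' with
  | mem_mul_mem g hg h hh =>
    rw [pointIdeal_eq_span] at hg hh
    obtain ⟨a, rfl⟩ := Ideal.mem_span_range_iff_exists_fun.1 hg
    obtain ⟨b, rfl⟩ := Ideal.mem_span_range_iff_exists_fun.1 hh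
    refine ⟨fun k l => a k * b l, ?_⟩
    rw [Finset.sum_mul_sum]
    exact Finset.sum_congr rfl fun k _ => Finset.sum_congr rfl fun l _ => by ring
  | add f _ g _ hf hg =>
    obtain ⟨s, rfl⟩ := hf
    obtain ⟨t, rfl⟩ := hg
    exact ⟨fun k l => s k l + t k l, by simp only [add_mul, Finset.sum_add_distrib]⟩

theorem hessAt_sum_apply (x : Fin n → A) (s : Fin n → Fin n → MvPolynomial (Fin n) A)
    (i j : Fin n) :
    hessAt (∑ k, ∑ l, s k l * ((X k - C (x k)) * (X l - C (x l)))) x i j =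
      eval x (s i j) + eval x (s j i) := by
  have hterm : ∀ k l, eval x (pderiv i (pderiv j
      (s k l * ((X k - C (x k)) * (X l - C (x l)))))) =
      (if k = i then if l = j then eval x (s k l) else 0 else 0) +
        (if k = j then if l = i then eval x (s k l) else 0 else 0) := by
    intro k l
    have hX : ∀ a b : Fin n, pderiv a (X b - C (x b)) = C (if b = a then 1 else 0) := by
      intro a b
      rw [map_sub, pderiv_C, sub_zero, pderiv_X, Pi.single_apply]
      split_ifs <;> simp
    simp only [pderiv_mul, map_add, map_mul, hX, pderiv_C, eval_C, eval_X, map_sub, sub_self,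
      map_zero]
    split_ifs <;> simp [mul_add]
  simp only [hessAt, hess, map_apply, of_apply, map_sum, hterm, Finset.sum_add_distrib]
  simp

end PointIdeals

/-! ### Ring homomorphisms to the real numbers -/

section StandardPart

variable {R : Type*} [Field R] [LinearOrder R] [IsStrictOrderedRing R]

theorem mk_val_nonneg (a : FiniteElement R) : 0 ≤ ArchimedeanClass.mk a.1 := a.2

/-- The standard part as a ring homomorphism. -/
noncomputable def stHom : FiniteElement R →+* ℝ where
  toFun := st
  map_zero' := stdPart_zero
  map_one' := stdPart_one
  map_add' a b := stdPart_add (mk_val_nonneg a) (mk_val_nonneg b)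
  map_mul' a b := stdPart_mul (mk_val_nonneg a) (mk_val_nonneg b)

theorem stHom_apply (a : FiniteElement R) : stHom a = st a := rfl

theorem isUnit_of_st_ne_zero {a : FiniteElement R} (h : st a ≠ 0) : IsUnit a := by
  rw [FiniteElement.isUnit_iff_mk_eq_zero]
  by_contra h'
  exact h (stdPart_eq_zero.2 h')

theorem isSquare_of_nonneg [IsRealClosed R] {a : FiniteElement R} (ha : 0 ≤ a) : IsSquare a := by
  have ha' : 0 ≤ a.1 := ha
  obtain ⟨c, hc⟩ := IsRealClosed.nonneg_iff_isSquare.1 ha'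
  have hcfin : 0 ≤ ArchimedeanClass.mk c := by
    rw [mk_nonneg_iff]
    obtain ⟨N, -, hN⟩ := (mk_nonneg_iff a.1).1 (mk_val_nonneg a)
    have hN0 : (0 : R) ≤ N := N.cast_nonneg
    rw [hc] at hN
    refine ⟨N + 1, ?_⟩
    push_cast
    constructor <;> nlinarith
  exact ⟨FiniteElement.mk c hcfin, FiniteElement.ext hc⟩

variable [Algebra ℝ R]

theorem st_ofReal (r : ℝ) : st (ofReal R r) = r :=
  RingHom.congr_fun (Subsingleton.elim (stHom.comp (ofReal R)) (RingHom.id ℝ)) r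

variable [IsRealClosed R]

/-- The standard part is the only ring homomorphism from the finite elements to the reals: such a
homomorphism is monotone, since nonnegative finite elements are squares, and fixes the reals. -/
theorem ringHom_eq_stHom (Φ : FiniteElement R →+* ℝ) : Φ = stHom := by
  have hmono : ∀ {a b : FiniteElement R}, a ≤ b → Φ a ≤ Φ b := by
    intro a b hab
    obtain ⟨c, hc⟩ := isSquare_of_nonneg (sub_nonneg.2 hab)
    have := congrArg Φ hc
    rw [map_sub, map_mul] at this
    nlinarith [mul_self_nonneg (Φ c)]
  have hreal : ∀ r : ℝ, Φ (ofReal R r) = r := fun r =>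
    RingHom.congr_fun (Subsingleton.elim (Φ.comp (ofReal R)) (RingHom.id ℝ)) r
  let ι : ℝ →+*o R := ⟨algebraMap ℝ R, fun a b hab => by
    have := algebraMap_nonneg (R := R) (sub_nonneg.2 hab)
    rw [map_sub] at this
    exact sub_nonneg.1 this⟩
  ext a
  rw [stHom_apply]
  refine le_antisymm (le_of_forall_gt_imp_ge_of_dense fun s hs => ?_)
    (le_of_forall_lt_imp_le_of_dense fun s hs => ?_)
  · have h : a ≤ ofReal R s := (lt_of_stdPart_lt ι (mk_val_nonneg a) hs).le
    simpa [hreal] using hmono h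
  · have h : ofReal R s ≤ a := (lt_of_lt_stdPart ι (mk_val_nonneg a) hs).le
    simpa [hreal] using hmono h

/-- A ring homomorphism from polynomials over the finite elements to the reals is the standard part
of the evaluation at any point whose standard part is the image of the variables. -/
theorem ringHom_apply_eq_st_eval {n : ℕ} (Φ : MvPolynomial (Fin n) (FiniteElement R) →+* ℝ)
    {x : Fin n → FiniteElement R} (hx : ∀ i, st (x i) = Φ (X i))
    (p : MvPolynomial (Fin n) (FiniteElement R)) : Φ p = st (eval x p) := by
  have h : Φ = stHom.comp (eval x) := by
    refine MvPolynomial.ringHom_ext (fun a => ?_) (fun i => ?_)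
    · rw [RingHom.comp_apply, eval_C]
      exact RingHom.congr_fun (ringHom_eq_stHom (Φ.comp C)) a
    · rw [RingHom.comp_apply, eval_X, stHom_apply, hx]
  rw [h]
  rfl

end StandardPart

/-! ### Positivity of the pairing of Hessian and Gram matrix -/

section Hessian

theorem sum_mul_pos_of_posSemidef {ι : Type*} [Fintype ι] {H B : Matrix ι ι ℝ}
    (hH : ∀ v : ι → ℝ, v ≠ 0 → 0 < v ⬝ᵥ H *ᵥ v) (hB : B.PosSemidef) (hB0 : B ≠ 0) :
    0 < ∑ i, ∑ j, H i j * B i j := by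
  classical
  obtain ⟨L, rfl⟩ : ∃ L : Matrix ι ι ℝ, B = Lᴴ * L := by
    open scoped MatrixOrder in
    exact CStarAlgebra.nonneg_iff_eq_star_mul_self.1 hB.nonneg
  have hsum : ∑ i, ∑ j, H i j * (Lᴴ * L) i j = ∑ r, L r ⬝ᵥ H *ᵥ L r := by
    simp only [mul_apply, conjTranspose_apply, star_trivial, dotProduct, mulVec, Finset.mul_sum]
    rw [Finset.sum_comm_cycle]
    refine Finset.sum_congr rfl fun r _ => ?_
    exact Finset.sum_congr rfl fun i _ => Finset.sum_congr rfl fun j _ => by ring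
  rw [hsum]
  have hnn : ∀ r, 0 ≤ L r ⬝ᵥ H *ᵥ L r := fun r => by
    rcases eq_or_ne (L r) 0 with h | h
    · simp [h]
    · exact (hH _ h).le
  obtain ⟨r, hr⟩ : ∃ r, L r ≠ 0 := by
    by_contra! h
    exact hB0 (by rw [show L = 0 from funext h, mul_zero])
  exact Finset.sum_pos' (fun r _ => hnn r) ⟨r, Finset.mem_univ r, hH _ hr⟩

variable {A : Type*} [CommRing A] [Algebra ℝ A] {J : Ideal A} {n : ℕ}

/-- The Gram matrix of finitely many elements of `J` under a functional on `J²`. -/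
def gramMatrix (φ : ↥(J ^ 2) →ₗ[ℝ] ℝ) (c : Fin n → ↥J) : Matrix (Fin n) (Fin n) ℝ :=
  Matrix.of fun k l => φ ⟨c k * c l, pow_two J ▸ Ideal.mul_mem_mul (c k).2 (c l).2⟩

theorem posSemidef_gramMatrix {M : Set A} (hM : IsQuadraticModule M) {φ : ↥(J ^ 2) →ₗ[ℝ] ℝ}
    (hφ : ∀ b : ↥(J ^ 2), (b : A) ∈ M → 0 ≤ φ b) (c : Fin n → ↥J) :
    (gramMatrix φ c).PosSemidef := by
  refine .of_dotProduct_mulVec_nonneg ?_ fun v => ?_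
  · ext k l
    simp only [gramMatrix, conjTranspose_apply, of_apply, star_trivial]
    congr 2
    exact mul_comm _ _
  · have hmem : (∑ k, v k • (c k : A)) ^ 2 ∈ J ^ 2 :=
      Ideal.pow_mem_pow (Ideal.sum_mem _ fun k _ =>
        Submodule.smul_of_tower_mem J (v k) (c k).2) 2
    have h := hφ ⟨_, hmem⟩ (hM.sq_mem _)
    have hexp : (⟨_, hmem⟩ : ↥(J ^ 2)) = ∑ k, ∑ l, (v k * v l) •
        (⟨c k * c l, pow_two J ▸ Ideal.mul_mem_mul (c k).2 (c l).2⟩ : ↥(J ^ 2)) := by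
      ext
      simp only [pow_two, Finset.sum_mul_sum, Submodule.coe_sum, Submodule.coe_smul_of_tower,
        smul_mul_smul_comm]
    rw [hexp] at h
    simp only [map_sum, map_smul, smul_eq_mul] at h
    refine h.trans_eq ?_
    simp only [dotProduct, mulVec, gramMatrix, of_apply, star_trivial, Finset.mul_sum]
    exact Finset.sum_congr rfl fun k _ => Finset.sum_congr rfl fun l _ => by ring

end Hessian

/-! ### Pure states concentrated at one of the points -/

section Assembly

variable {R : Type*} [Field R] [LinearOrder R] [IsStrictOrderedRing R] {n k : ℕ}

theorem isCoprime_pointIdeal_of_stPt_ne {x y : Fin n → FiniteElement R} (h : stPt x ≠ stPt y) :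
    IsCoprime (pointIdeal x) (pointIdeal y) := by
  obtain ⟨i, hi⟩ := Function.ne_iff.1 h
  refine isCoprime_pointIdeal (i := i) (isUnit_of_st_ne_zero ?_)
  rw [← stHom_apply, map_sub]
  exact sub_ne_zero.2 hi

theorem iInf_pointIdeal_sq {x : Fin k → Fin n → FiniteElement R}
    (hx : ∀ i j : Fin k, i ≠ j → stPt (x i) ≠ stPt (x j)) :
    ⨅ i, pointIdeal (x i) ^ 2 = (∏ i, pointIdeal (x i)) ^ 2 := by
  have h := Ideal.prod_eq_iInf_of_pairwise_isCoprime (s := Finset.univ)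
    (J := fun i => pointIdeal (x i) ^ 2)
    fun i _ j _ hij => (isCoprime_pointIdeal_of_stPt_ne (hx i j hij)).pow
  rw [← Finset.prod_pow, h]
  simp

theorem prod_pointIdeal_fg (x : Fin k → Fin n → FiniteElement R) :
    (∏ i, pointIdeal (x i)).FG :=
  Finset.prod_induction _ Ideal.FG (fun _ _ => Ideal.FG.mul)
    (by rw [Ideal.one_eq_top]; exact ⟨{1}, by simp⟩) fun i _ => pointIdeal_fg (x i)

/-- A polynomial that vanishes at all points other than `x i`, but does not vanish infinitesimally
close to `x i`. -/
theorem exists_separating {x : Fin k → Fin n → FiniteElement R}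
    (hx : ∀ i j : Fin k, i ≠ j → stPt (x i) ≠ stPt (x j)) (i : Fin k) :
    ∃ e : MvPolynomial (Fin n) (FiniteElement R), st (eval (x i) e) ≠ 0 ∧
      ∀ g ∈ pointIdeal (x i), e * g ∈ ∏ j, pointIdeal (x j) := by
  classical
  have hq : ∀ j, ∃ q ∈ pointIdeal (x j), j ≠ i → st (eval (x i) q) ≠ 0 := by
    intro j
    rcases eq_or_ne j i with h | h
    · exact ⟨0, Ideal.zero_mem _, fun h' => absurd h h'⟩
    · obtain ⟨m, hm⟩ := Function.ne_iff.1 (hx i j h.symm)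
      refine ⟨X m - C (x j m), X_sub_C_mem_pointIdeal _ _, fun _ => ?_⟩
      rw [map_sub, eval_X, eval_C, ← stHom_apply, map_sub]
      exact sub_ne_zero.2 hm
  choose q hq hq0 using hq
  refine ⟨∏ j ∈ Finset.univ.erase i, q j, ?_, fun g hg => ?_⟩
  · rw [← stHom_apply, map_prod, map_prod, Finset.prod_ne_zero_iff]
    exact fun j hj => hq0 j (Finset.ne_of_mem_erase hj)
  · rw [← Finset.prod_erase_mul _ _ (Finset.mem_univ i)]
    exact Ideal.mul_mem_mul (Ideal.prod_mem_prod fun j _ => hq j) hg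

/-- If the ring acts on a functional on `J²` through evaluation near a point `x`, then the values of
that functional are given by pairing the Hessian at `x` with a Gram matrix. Here `J` may be smaller
than the ideal of `x`, but contains its multiples by `e`. -/
theorem two_mul_map_eq_sum_hessAt_mul_gramMatrix
    [Algebra ℝ (MvPolynomial (Fin n) (FiniteElement R))]
    {J : Ideal (MvPolynomial (Fin n) (FiniteElement R))} {φ : ↥(J ^ 2) →ₗ[ℝ] ℝ}
    {x : Fin n → FiniteElement R} (hφ : ∀ a b, φ (a • b) = st (eval x a) * φ b)
    {e : MvPolynomial (Fin n) (FiniteElement R)} (he : ∀ g ∈ pointIdeal x, e * g ∈ J)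
    {b : ↥(J ^ 2)} (hb : (b : MvPolynomial (Fin n) (FiniteElement R)) ∈ pointIdeal x ^ 2) :
    2 * (st (eval x e) ^ 2 * φ b) = ∑ i, ∑ j, st (hessAt b.1 x i j) *
      gramMatrix φ (fun i => ⟨e * (X i - C (x i)), he _ (X_sub_C_mem_pointIdeal x i)⟩) i j := by
  set c : Fin n → ↥J := fun i => ⟨e * (X i - C (x i)), he _ (X_sub_C_mem_pointIdeal x i)⟩
  obtain ⟨s, hs⟩ := exists_eq_sum_of_mem_pointIdeal_sq hb
  have hsymm : ∀ i j, gramMatrix φ c i j = gramMatrix φ c j i := fun i j => by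
    simp only [gramMatrix, of_apply]
    congr 2
    exact mul_comm _ _
  have hexp : e ^ 2 • b = ∑ i, ∑ j, s i j •
      (⟨c i * c j, pow_two J ▸ Ideal.mul_mem_mul (c i).2 (c j).2⟩ : ↥(J ^ 2)) := by
    ext1
    simp only [Submodule.coe_sum, Submodule.coe_smul, smul_eq_mul, hs, Finset.mul_sum]
    exact Finset.sum_congr rfl fun i _ => Finset.sum_congr rfl fun j _ => by ring
  have hval : st (eval x e) ^ 2 * φ b = ∑ i, ∑ j, st (eval x (s i j)) * gramMatrix φ c i j := by
    have h := hφ (e ^ 2) b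
    rw [hexp, map_pow, ← stHom_apply, map_pow, stHom_apply] at h
    rw [← h]
    simp only [map_sum, hφ, gramMatrix, of_apply]
  have hval' : st (eval x e) ^ 2 * φ b = ∑ i, ∑ j, st (eval x (s j i)) * gramMatrix φ c i j := by
    rw [hval, Finset.sum_comm]
    exact Finset.sum_congr rfl fun i _ => Finset.sum_congr rfl fun j _ => by rw [hsymm]
  rw [two_mul]
  nth_rewrite 1 [hval]
  rw [hval', ← Finset.sum_add_distrib]
  refine Finset.sum_congr rfl fun i _ => ?_
  rw [← Finset.sum_add_distrib]
  refine Finset.sum_congr rfl fun j _ => ?_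
  rw [hs, hessAt_sum_apply, ← add_mul]
  simp only [← stHom_apply, map_add]

/-- A nonzero state on which the ring acts through evaluation near `x` is positive at every `f`
whose Hessian at `x` has positive definite standard part. -/
theorem map_pos_of_hessAt_pos [Algebra ℝ (MvPolynomial (Fin n) (FiniteElement R))]
    {M : Set (MvPolynomial (Fin n) (FiniteElement R))} (hM : IsQuadraticModule M)
    {J : Ideal (MvPolynomial (Fin n) (FiniteElement R))} {φ : ↥(J ^ 2) →ₗ[ℝ] ℝ}
    (hpos : ∀ b : ↥(J ^ 2), (b : MvPolynomial (Fin n) (FiniteElement R)) ∈ M → 0 ≤ φ b)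
    {x : Fin n → FiniteElement R} (hφ : ∀ a b, φ (a • b) = st (eval x a) * φ b)
    {e : MvPolynomial (Fin n) (FiniteElement R)} (he : ∀ g ∈ pointIdeal x, e * g ∈ J)
    (he0 : st (eval x e) ≠ 0) (hJ : J ≤ pointIdeal x) {u f : ↥(J ^ 2)} (hu : φ u ≠ 0)
    (hf : ∀ v : Fin n → ℝ, v ≠ 0 →
      0 < v ⬝ᵥ (Matrix.of fun i j => st (hessAt f.1 x i j)) *ᵥ v) :
    0 < φ f := by
  have hval := fun b : ↥(J ^ 2) =>
    two_mul_map_eq_sum_hessAt_mul_gramMatrix hφ he (Ideal.pow_right_mono hJ 2 b.2)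
  set c : Fin n → ↥J := fun i => ⟨e * (X i - C (x i)), he _ (X_sub_C_mem_pointIdeal x i)⟩
  have hB0 : gramMatrix φ c ≠ 0 := by
    intro h0
    have h := hval u
    simp [h0, he0, hu] at h
  have h := sum_mul_pos_of_posSemidef hf (posSemidef_gramMatrix hM hpos c) hB0
  simp only [of_apply] at h
  rw [← hval f] at h
  exact pos_of_mul_pos_right (pos_of_mul_pos_right h zero_le_two) (sq_nonneg _)

variable [Algebra ℝ R]

theorem st_dotProduct_mulVec (H : Matrix (Fin n) (Fin n) (FiniteElement R))
    (v : Fin n → ℝ) :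
    st (ofRealPt R v ⬝ᵥ H *ᵥ ofRealPt R v) = v ⬝ᵥ (Matrix.of fun i j => st (H i j)) *ᵥ v := by
  rw [← stHom_apply]
  simp only [dotProduct, mulVec, map_sum, map_mul, stHom_apply, ofRealPt, st_ofReal, of_apply]

end Assembly

end RealClosedPositivity

theorem mainTheorem8
    {R : Type*} [Field R] [LinearOrder R] [IsStrictOrderedRing R] [IsRealClosed R] [Algebra ℝ R]
    (n : ℕ) (M : Set (MvPolynomial (Fin n) (FiniteElement R)))
    (hM : IsQuadraticModule M) (hMarch : IsArchimedean M)
    (k : ℕ) (x : Fin k → Fin n → FiniteElement R)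
    (hx : ∀ i j : Fin k, i ≠ j → stPt (x i) ≠ stPt (x j))
    (f : MvPolynomial (Fin n) (FiniteElement R))
    (hf : f ∈ ⨅ i : Fin k, pointIdeal (x i) ^ 2)
    (hpos : ∀ y ∈ positivitySet M \ Set.range (fun i : Fin k => stPt (x i)),
      0 < st (MvPolynomial.eval (ofRealPt R y) f))
    (hhess : ∀ (i : Fin k) (v : Fin n → ℝ), v ≠ 0 →
      0 < st (dotProduct (ofRealPt R v) (Matrix.mulVec (hessAt f (x i)) (ofRealPt R v)))) :
    f ∈ M := by
  let _ : Algebra ℝ (FiniteElement R) := (ofReal R).toAlgebra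
  by_contra hfM
  rw [iInf_pointIdeal_sq hx] at hf
  obtain ⟨φ, Φ, u, hφ, hΦ, hmul, huM, hφu, hφf⟩ :=
    hMarch.exists_multiplicative_state hM (prod_pointIdeal_fg x) (f := ⟨f, hf⟩) hfM
  refine hφf.not_gt ?_
  -- `Φ` is the standard part of the evaluation at the real point `y`.
  let y : Fin n → ℝ := fun i => Φ (MvPolynomial.X i)
  have hΦy := ringHom_apply_eq_st_eval Φ (x := ofRealPt R y) fun i => st_ofReal _
  by_cases hy : y ∈ Set.range fun i : Fin k => stPt (x i)
  · obtain ⟨i, hi⟩ := hy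
    have hΦx := ringHom_apply_eq_st_eval Φ (x := x i) fun j => congrFun hi j
    obtain ⟨e, he0, he⟩ := exists_separating hx i
    refine map_pos_of_hessAt_pos hM hφ (fun a b => by rw [hmul, hΦx]) he he0
      (Ideal.prod_le_inf.trans (Finset.inf_le (Finset.mem_univ i)))
      (u := u) (by rw [hφu]; exact one_ne_zero) fun v hv => ?_
    rw [← st_dotProduct_mulVec]
    exact hhess i v hv
  · have hyS : y ∈ positivitySet M := fun p hp => by
      rw [← hΦy]
      exact hΦ p hp
    have hΦf : 0 < Φ f := by
      rw [hΦy]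
      exact hpos y ⟨hyS, hy⟩
    -- Both `f • u` and `u • f` are the product `f u`, so `Φ f = Φ u * φ f`.
    have hcomm : f • u = (u : MvPolynomial (Fin n) (FiniteElement R)) •
        (⟨f, hf⟩ : ↥((∏ i, pointIdeal (x i)) ^ 2)) := Subtype.ext (mul_comm _ _)
    have h := hmul f u
    rw [hcomm, hmul, hφu, mul_one] at h
    rw [← h] at hΦf
    exact pos_of_mul_pos_right hΦf (hΦ _ huM)
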